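/- Let $A,B,P$ be real $n\times n$ matrices with $P$ invertible and $A=P^{-1}BP$, where $B$ is in real Jordan canonical form, i.e. $B$ is block diagonal and each diagonal block is either a $p\times p$ Jordan block ($p\ge1$) with a real eigenvalue $\lambda$ (entries $\lambda$ on the diagonal and $1$ on the superdiagonal), or a $2m\times 2m$ block ($m\ge 1$) with the $2\times2$ matrix $\begin{pmatrix}a&b\\-b&a\end{pmatrix}$, $a,b\in\mathbb R$, $b>0$, repeated on the block diagonal and the identity $I_2$ on the block superdiagonal. Let $$\tilde S=\Big\{P^{-1}v \;\Big|\; v=(v_1,\dots,v_n)^{\mathrm T}\in\mathbb R^n,\ \prod_{i=1}^n v_i\neq0\Big\}.$$ For a solution $r(t)$ of $\dot r(t)=Ar(t)$ let $\kappa(t)=\frac{1}{\|\dot r(t)\|}\Big\|\frac{d}{dt}\frac{\dot r(t)}{\|\dot r(t)\|}\Big\|$ be the first curvature of its trajectory in $\mathbb R^n$ with the Euclidean norm (that is, the norm of the derivative of the unit tangent with respect to arc length), with $\kappa\equiv0$ if $r$ is constant. Then: 1. if $\lim_{t\to+\infty}\kappa(t)=0$ for some initial value $r(0)\in\tilde S$,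 then $\lim_{t\to+\infty}\kappa(t)=0$ for every initial value $r(0)\in\tilde S$; 2. if $\lim_{t\to+\infty}\kappa(t)=+\infty$ for some initial value $r(0)\in\tilde S$, then $\lim_{t\to+\infty}\kappa(t)=+\infty$ for every initial value $r(0)\in\tilde S$; 3. if $\kappa$ is a bounded function on $[0,+\infty)$ for some initial value $r(0)\in\tilde S$, then $\kappa$ is a bounded function on $[0,+\infty)$ for every initial value $r(0)\in\tilde S$ (with a bound that may depend on $r(0)$). -/

import Mathlib

open Filter Topology

/-- `r : ℝ → ℝⁿ` is a solution (trajectory) of the linear time-invariant system `ṙ(t) = A r(t)`. -/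
def IsTrajectory {n : ℕ} (A : Matrix (Fin n) (Fin n) ℝ) (r : ℝ → EuclideanSpace ℝ (Fin n)) : Prop :=
  ∀ t : ℝ, HasDerivAt r (Matrix.toEuclideanLin A (r t)) t

/-- The unit tangent vector `H₁(t) = ṙ(t) / ‖ṙ(t)‖` of a curve in `ℝⁿ`. -/
noncomputable def unitTangent {n : ℕ} (r : ℝ → EuclideanSpace ℝ (Fin n)) (t : ℝ) :
    EuclideanSpace ℝ (Fin n) :=
  ‖deriv r t‖⁻¹ • deriv r t

/-- The first curvature `κ(t)` of a regular curve in `ℝⁿ`: the norm of the derivative of the unit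
tangent with respect to arc length `s`, where `d/ds = ‖ṙ(t)‖⁻¹ d/dt`.
For a constant curve this gives `κ = 0`, the usual convention for an equilibrium. -/
noncomputable def firstCurvature {n : ℕ} (r : ℝ → EuclideanSpace ℝ (Fin n)) (t : ℝ) : ℝ :=
  ‖deriv r t‖⁻¹ * ‖deriv (unitTangent r) t‖

/-- The data of a real Jordan block: a `p × p` block `J_p(μ)` with a real eigenvalue `μ`, or a
`2m × 2m` block `C_m(a, b)` with eigenvalues `a ± b √-1`, `b > 0`. -/
inductive RealJordanBlock : Type
  | real (μ : ℝ) (p : ℕ) (hp : 0 < p) : RealJordanBlock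
  | complex (a b : ℝ) (hb : 0 < b) (m : ℕ) (hm : 0 < m) : RealJordanBlock

namespace RealJordanBlock

/-- The number of rows of a real Jordan block. -/
def size : RealJordanBlock → ℕ
  | real _ p _ => p
  | complex _ _ _ m _ => m * 2

/-- The upper bidiagonal matrix `J_p(μ)`: `μ` on the diagonal, `1` on the superdiagonal. -/
def realMatrix (μ : ℝ) (p : ℕ) : Matrix (Fin p) (Fin p) ℝ :=
  Matrix.of fun i j => if j = i then μ else if (j : ℕ) = i + 1 then 1 else 0

/-- The matrix `C_m(a, b)`: the `2 × 2` blocks `Λ = !![a, b; -b, a]` on the block diagonal and the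
identity matrix `I₂` on the block superdiagonal. Row `(i, k)` (row `k` of block row `i`) is placed
at position `2 i + k`. -/
def complexMatrix (a b : ℝ) (m : ℕ) : Matrix (Fin (m * 2)) (Fin (m * 2)) ℝ :=
  Matrix.reindex finProdFinEquiv finProdFinEquiv
    (Matrix.of fun x y : Fin m × Fin 2 =>
      if y.1 = x.1 then (!![a, b; -b, a] : Matrix (Fin 2) (Fin 2) ℝ) x.2 y.2
      else if (y.1 : ℕ) = x.1 + 1 then (1 : Matrix (Fin 2) (Fin 2) ℝ) x.2 y.2
      else 0)

/-- The matrix of a real Jordan block. -/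
def toMatrix : (J : RealJordanBlock) → Matrix (Fin J.size) (Fin J.size) ℝ
  | real μ p _ => realMatrix μ p
  | complex a b _ m _ => complexMatrix a b m

end RealJordanBlock

/-- `B` is in real Jordan canonical form: it is a block diagonal matrix
`diag(J₁, …, J_q)` of real Jordan blocks. The equivalence `finSigmaFinEquiv` lists the rows of `J₁`,
then those of `J₂`, and so on. -/
def IsRealJordanForm {n : ℕ} (B : Matrix (Fin n) (Fin n) ℝ) : Prop :=
  ∃ (q : ℕ) (J : Fin q → RealJordanBlock) (h : ∑ i, (J i).size = n),
    B = Matrix.reindex (finSigmaFinEquiv.trans (finCongr h)) (finSigmaFinEquiv.trans (finCongr h))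
      (Matrix.blockDiagonal' fun i => (J i).toMatrix)

/-- The set `S̃ = {P⁻¹ v : v₁ v₂ ⋯ vₙ ≠ 0}` of initial values. -/
def genericInitialValues {n : ℕ} (P : Matrix (Fin n) (Fin n) ℝ) : Set (EuclideanSpace ℝ (Fin n)) :=
  {x | ∃ v : EuclideanSpace ℝ (Fin n), (∏ i, v i) ≠ 0 ∧ x = Matrix.toEuclideanLin P⁻¹ v}

/-! Any two initial values in `genericInitialValues P` are carried to each other by matrices
commuting with `A`: the centralizer of a Jordan block contains enough block Toeplitz matrices to
send a vector with nonzero entries anywhere (`IsRealJordanForm.exists_commute`). Such a matrix `D`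
maps trajectories to trajectories, hence velocities to velocities and accelerations to
accelerations. Curvature is the distance from acceleration to the tangent line over squared speed.
`D` enlarges that distance by at most the factor `‖D‖`, and the matrix `D'` going back bounds the
loss of speed. So two generic curvatures bound each other up to constants independent of time
(`IsTrajectory.firstCurvature_le`), which gives all three claims. -/

/-! ### Block Toeplitz operators commuting with a Jordan block -/

section Centralizer

variable {E : Type*} [AddCommGroup E] [Module ℝ E]

/-- The block Toeplitz endomorphism of `E ^ m` with `Q` on the `j`-th block superdiagonal. -/
def blockShift (m j : ℕ) (Q : Module.End ℝ E) : Module.End ℝ (Fin m → E) where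
  toFun f i := if h : (i : ℕ) + j < m then Q (f ⟨i + j, h⟩) else 0
  map_add' f g := by
    ext i
    by_cases h : (i : ℕ) + j < m <;> simp [h]
  map_smul' c f := by
    ext i
    by_cases h : (i : ℕ) + j < m <;> simp [h]

theorem blockShift_apply (m j : ℕ) (Q : Module.End ℝ E) (f : Fin m → E) (i : Fin m) :
    blockShift m j Q f i = if h : (i : ℕ) + j < m then Q (f ⟨i + j, h⟩) else 0 := rfl

theorem blockShift_mul (m j k : ℕ) (Q L : Module.End ℝ E) :
    blockShift m j Q * blockShift m k L = blockShift m (j + k) (Q * L) := by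
  refine LinearMap.ext fun f => funext fun i => ?_
  simp only [Module.End.mul_apply, blockShift_apply, ← add_assoc]
  by_cases h : (i : ℕ) + j + k < m
  · rw [dif_pos (by omega), dif_pos h, dif_pos h]
  · rw [dif_neg h]
    split_ifs <;> simp

theorem Commute.blockShift {Q L : Module.End ℝ E} (h : Commute Q L) (m j k : ℕ) :
    Commute (blockShift m j Q) (blockShift m k L) := by
  rw [Commute, SemiconjBy, blockShift_mul, blockShift_mul, h.eq, add_comm]

/-- Any vector is the image of `v` under an endomorphism commuting with the Jordan block
`blockShift m 0 L + blockShift m 1 1`, provided the last component of `v` generates `E` over the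
centralizer of `L`. -/
theorem exists_commute_jordanBlock {m : ℕ} (L : Module.End ℝ E) (v w : Fin m → E)
    (hv : ∀ i : Fin m, ∀ e, ∃ Q : Module.End ℝ E, Commute Q L ∧ Q (v i) = e) :
    ∃ T : Module.End ℝ (Fin m → E),
      Commute T (blockShift m 0 L + blockShift m 1 1) ∧ T v = w := by
  -- Back substitution: induct on a bound `k` for the support of the target `w`.
  suffices H : ∀ k ≤ m, ∀ w : Fin m → E, (∀ i : Fin m, k ≤ i → w i = 0) →
      ∃ T : Module.End ℝ (Fin m → E),
        Commute T (blockShift m 0 L + blockShift m 1 1) ∧ T v = w from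
    H m le_rfl w fun i hi => absurd i.2 (not_lt.2 hi)
  intro k
  induction k with
  | zero =>
    intro _ w hw
    exact ⟨0, Commute.zero_left _, funext fun i => (hw i (Nat.zero_le _)).symm⟩
  | succ k ih =>
    intro hk w hw
    -- The shift by `m - 1 - k` brings the last component of `v` to position `k` and vanishes below
    -- it, so subtracting it clears entry `k` of `w` and creates none after it.
    obtain ⟨Q, hQ, hQv⟩ := hv ⟨m - 1, by omega⟩ (w ⟨k, hk⟩)
    obtain ⟨T, hT, hTv⟩ := ih (by omega) (w - blockShift m (m - 1 - k) Q v) fun i hi => by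
      rw [Pi.sub_apply, blockShift_apply]
      rcases hi.eq_or_lt with h | h
      · have hi' : i = ⟨k, hk⟩ := Fin.ext h.symm
        have hlast : (⟨i + (m - 1 - k), by omega⟩ : Fin m) = ⟨m - 1, by omega⟩ :=
          Fin.ext (by simp only; omega)
        rw [dif_pos (by omega), hlast, hQv, hi', sub_self]
      · rw [dif_neg (by omega), hw i h, sub_zero]
    refine ⟨T + blockShift m (m - 1 - k) Q, hT.add_left ?_, ?_⟩
    · exact (hQ.blockShift m _ 0).add_right ((Commute.one_right Q).blockShift m _ 1)
    · rw [LinearMap.add_apply, hTv, sub_add_cancel]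

end Centralizer

/-! ### Transitivity of the centralizer for real Jordan forms -/

namespace RealJordanBlock

theorem exists_commute_realMatrix (μ : ℝ) (p : ℕ) (v w : Fin p → ℝ) (hv : ∀ i, v i ≠ 0) :
    ∃ C : Matrix (Fin p) (Fin p) ℝ, Commute C (realMatrix μ p) ∧ C.mulVec v = w := by
  obtain ⟨T, hT, hTv⟩ := exists_commute_jordanBlock (μ • (1 : Module.End ℝ ℝ)) v w fun i e =>
    ⟨(e / v i) • 1, (Commute.one_left _).smul_left _, by simp [hv i]⟩
  have hM : Matrix.toLin' (realMatrix μ p) =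
      blockShift p 0 (μ • (1 : Module.End ℝ ℝ)) + blockShift p 1 1 := by
    refine LinearMap.ext fun f => funext fun i => ?_
    rw [Matrix.toLin'_apply, LinearMap.add_apply, Pi.add_apply, blockShift_apply, blockShift_apply]
    simp only [Matrix.mulVec, dotProduct, realMatrix, Matrix.of_apply]
    have hsplit : ∀ j : Fin p, (if j = i then μ else if (j : ℕ) = i + 1 then 1 else 0) * f j =
        (if j = i then μ * f j else 0) + (if (j : ℕ) = i + 1 then f j else 0) := by
      intro j
      by_cases h1 : j = i
      · subst h1; simp
      · by_cases h2 : (j : ℕ) = i + 1 <;> simp [h1, h2]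
    rw [Finset.sum_congr rfl fun j _ => hsplit j, Finset.sum_add_distrib]
    congr 1
    · simp
    · by_cases h : (i : ℕ) + 1 < p
      · rw [dif_pos h, Finset.sum_eq_single ⟨i + 1, h⟩]
        · simp
        · intro j _ hj
          exact if_neg fun h' => hj (Fin.ext h')
        · simp
      · rw [dif_neg h]
        exact Finset.sum_eq_zero fun j _ => if_neg (by omega)
  refine ⟨LinearMap.toMatrix' T, ?_, ?_⟩
  · rw [← hM] at hT
    have := congrArg LinearMap.toMatrix' hT.eq
    rwa [LinearMap.toMatrix'_mul, LinearMap.toMatrix'_mul, LinearMap.toMatrix'_toLin'] at this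
  · rw [← Matrix.toLin'_apply, Matrix.toLin'_toMatrix', hTv]

/-- Identify `ℝ²` with `ℂ`: the matrix is multiplication by `a - b i`, which commutes with
multiplication by the quotient `e / z = c - d i`. -/
theorem exists_commute_rotation (a b : ℝ) (z e : Fin 2 → ℝ) (hz : ∀ i, z i ≠ 0) :
    ∃ Q : Module.End ℝ (Fin 2 → ℝ),
      Commute Q (Matrix.toLin' !![a, b; -b, a]) ∧ Q z = e := by
  have h0 := hz 0
  have hpos : z 0 ^ 2 + z 1 ^ 2 ≠ 0 := by positivity
  set c := (z 0 * e 0 + z 1 * e 1) / (z 0 ^ 2 + z 1 ^ 2) with hc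
  set d := (z 1 * e 0 - z 0 * e 1) / (z 0 ^ 2 + z 1 ^ 2) with hd
  refine ⟨Matrix.toLin' !![c, d; -d, c], ?_, ?_⟩
  · rw [Commute, SemiconjBy, Module.End.mul_eq_comp, Module.End.mul_eq_comp, ← Matrix.toLin'_mul,
      ← Matrix.toLin'_mul]
    congr 1
    ext i j
    fin_cases i <;> fin_cases j <;> simp <;> ring
  · ext i
    fin_cases i <;>
      simp [Matrix.toLin'_apply, Matrix.mulVec, dotProduct, Fin.sum_univ_two, hc, hd] <;>
      field_simp <;> ring

theorem exists_commute_complexMatrix (a b : ℝ) (m : ℕ) (v w : Fin (m * 2) → ℝ)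
    (hv : ∀ i, v i ≠ 0) :
    ∃ C : Matrix (Fin (m * 2)) (Fin (m * 2)) ℝ,
      Commute C (complexMatrix a b m) ∧ C.mulVec v = w := by
  -- Regroup the coordinates into `m` pairs, so that the matrix becomes a Jordan block over `E =
  -- ℝ²`.
  let φ : (Fin (m * 2) → ℝ) ≃ₗ[ℝ] (Fin m → Fin 2 → ℝ) :=
    (LinearEquiv.funCongrLeft ℝ ℝ finProdFinEquiv).trans (LinearEquiv.curry ℝ ℝ (Fin m) (Fin 2))
  have hφ : ∀ f i k, φ f i k = f (finProdFinEquiv (i, k)) := fun f i k => rfl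
  obtain ⟨T, hT, hTv⟩ := exists_commute_jordanBlock (Matrix.toLin' !![a, b; -b, a])
    (φ v) (φ w) fun i e => exists_commute_rotation a b (φ v i) e fun k => hv _
  have hM : φ.conj (Matrix.toLin' (complexMatrix a b m)) =
      blockShift m 0 (Matrix.toLin' !![a, b; -b, a]) + blockShift m 1 1 := by
    refine LinearMap.ext fun f => funext fun i => funext fun k => ?_
    obtain ⟨g, rfl⟩ := φ.surjective f
    rw [LinearEquiv.conj_apply_apply, LinearEquiv.symm_apply_apply, hφ, Matrix.toLin'_apply,
      LinearMap.add_apply, Pi.add_apply, Pi.add_apply, blockShift_apply, blockShift_apply]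
    set Λ : Matrix (Fin 2) (Fin 2) ℝ := !![a, b; -b, a] with hΛ
    have hentry : ∀ j l, complexMatrix a b m (finProdFinEquiv (i, k)) (finProdFinEquiv (j, l)) =
        if j = i then Λ k l else
          if (j : ℕ) = i + 1 then (1 : Matrix (Fin 2) (Fin 2) ℝ) k l else 0 := fun j l => by
      rw [complexMatrix, Matrix.reindex_apply, Matrix.submatrix_apply, Equiv.symm_apply_apply,
        Equiv.symm_apply_apply, Matrix.of_apply]
    rw [Matrix.mulVec, dotProduct, ← finProdFinEquiv.sum_comp, Fintype.sum_prod_type]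
    simp only [hentry, ← hφ g]
    have hsplit : ∀ j : Fin m, (∑ l, (if j = i then Λ k l else
          if (j : ℕ) = i + 1 then (1 : Matrix (Fin 2) (Fin 2) ℝ) k l else 0) * φ g j l) =
        (if j = i then ∑ l, Λ k l * φ g j l else 0) + (if (j : ℕ) = i + 1 then φ g j k else 0) := by
      intro j
      by_cases h1 : j = i
      · subst h1; simp
      · by_cases h2 : (j : ℕ) = i + 1 <;> simp [h1, h2, Matrix.one_apply]
    rw [Finset.sum_congr rfl fun j _ => hsplit j, Finset.sum_add_distrib]
    congr 1
    · simp [Matrix.toLin'_apply, Matrix.mulVec, dotProduct]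
    · by_cases h : (i : ℕ) + 1 < m
      · rw [dif_pos h, Finset.sum_eq_single ⟨i + 1, h⟩]
        · simp
        · intro j _ hj
          exact if_neg fun h' => hj (Fin.ext h')
        · simp
      · rw [dif_neg h]
        exact Finset.sum_eq_zero fun j _ => if_neg (by omega)
  refine ⟨LinearMap.toMatrix' (φ.symm.conj T), ?_, ?_⟩
  · rw [← hM] at hT
    have hT' : φ.symm.conj T * Matrix.toLin' (complexMatrix a b m) =
        Matrix.toLin' (complexMatrix a b m) * φ.symm.conj T := by
      refine LinearMap.ext fun f => φ.injective ?_
      simpa [LinearEquiv.conj_apply_apply] using LinearMap.congr_fun hT.eq (φ f)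
    have := congrArg LinearMap.toMatrix' hT'
    rwa [LinearMap.toMatrix'_mul, LinearMap.toMatrix'_mul, LinearMap.toMatrix'_toLin'] at this
  · rw [← Matrix.toLin'_apply, Matrix.toLin'_toMatrix', LinearEquiv.conj_apply_apply,
      LinearEquiv.symm_symm, hTv, LinearEquiv.symm_apply_apply]

theorem exists_commute_toMatrix (J : RealJordanBlock) (v w : Fin J.size → ℝ)
    (hv : ∀ i, v i ≠ 0) :
    ∃ C : Matrix (Fin J.size) (Fin J.size) ℝ, Commute C J.toMatrix ∧ C.mulVec v = w := by
  cases J with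
  | real μ p hp => exact exists_commute_realMatrix μ p v w hv
  | complex a b hb m hm => exact exists_commute_complexMatrix a b m v w hv

end RealJordanBlock

/-- The centralizer of a matrix in real Jordan form acts transitively on the vectors with nonzero
components. -/
theorem IsRealJordanForm.exists_commute {n : ℕ} {B : Matrix (Fin n) (Fin n) ℝ}
    (hB : IsRealJordanForm B) (v w : Fin n → ℝ) (hv : ∀ i, v i ≠ 0) :
    ∃ C : Matrix (Fin n) (Fin n) ℝ, Commute C B ∧ C.mulVec v = w := by
  obtain ⟨q, J, h, rfl⟩ := hB
  set e := finSigmaFinEquiv.trans (finCongr h)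
  choose C hC hCv using fun i => (J i).exists_commute_toMatrix (fun k => v (e ⟨i, k⟩))
    (fun k => w (e ⟨i, k⟩)) fun k => hv _
  refine ⟨Matrix.reindex e e (Matrix.blockDiagonal' C), ?_, ?_⟩
  · simp only [Commute, SemiconjBy, Matrix.reindex_apply, Matrix.submatrix_mul_equiv,
      ← Matrix.blockDiagonal'_mul]
    simp only [(hC _).eq]
  · ext x
    obtain ⟨⟨i, k⟩, rfl⟩ := e.surjective x
    rw [← congrFun (hCv i) k]
    simp only [Matrix.mulVec, dotProduct, Matrix.reindex_apply, Matrix.submatrix_apply,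
      Equiv.symm_apply_apply]
    rw [← e.sum_comp, Fintype.sum_sigma, Finset.sum_eq_single i]
    · simp [Matrix.blockDiagonal'_apply_eq]
    · intro j _ hj
      exact Finset.sum_eq_zero fun l _ => by
        rw [Equiv.symm_apply_apply, Matrix.blockDiagonal'_apply_ne _ _ _ hj.symm, zero_mul]
    · simp

/-! ### Curvature under linear maps commuting with the flow -/

section Curvature

variable {n : ℕ}

theorem IsTrajectory.deriv_eq {A : Matrix (Fin n) (Fin n) ℝ} {r : ℝ → EuclideanSpace ℝ (Fin n)}
    (hr : IsTrajectory A r) : deriv r = fun t => Matrix.toEuclideanLin A (r t) :=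
  funext fun t => (hr t).deriv

theorem IsTrajectory.hasDerivAt_deriv {A : Matrix (Fin n) (Fin n) ℝ}
    {r : ℝ → EuclideanSpace ℝ (Fin n)} (hr : IsTrajectory A r) (t : ℝ) :
    HasDerivAt (deriv r) (Matrix.toEuclideanLin A (deriv r t)) t := by
  rw [hr.deriv_eq]
  exact (Matrix.toEuclideanLin A).toContinuousLinearMap.hasFDerivAt.comp_hasDerivAt t (hr t)

theorem IsTrajectory.eq_of_initial_eq {A : Matrix (Fin n) (Fin n) ℝ}
    {r s : ℝ → EuclideanSpace ℝ (Fin n)} (hr : IsTrajectory A r) (hs : IsTrajectory A s)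
    (h : r 0 = s 0) : r = s :=
  ODE_solution_unique_univ (v := fun _ x => Matrix.toEuclideanLin A x) (s := fun _ => Set.univ)
    (t₀ := 0)
    (fun _ => (Matrix.toEuclideanLin A).toContinuousLinearMap.lipschitz.lipschitzOnWith)
    (fun t => ⟨hr t, Set.mem_univ _⟩) (fun t => ⟨hs t, Set.mem_univ _⟩) h

theorem IsTrajectory.map {A D : Matrix (Fin n) (Fin n) ℝ} {r : ℝ → EuclideanSpace ℝ (Fin n)}
    (hr : IsTrajectory A r) (hD : Commute D A) :
    IsTrajectory A fun t => Matrix.toEuclideanLin D (r t) := by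
  intro t
  refine ((Matrix.toEuclideanLin D).toContinuousLinearMap.hasFDerivAt.comp_hasDerivAt t
    (hr t)).congr_deriv ?_
  simp [Matrix.toLpLin_apply, Matrix.mulVec_mulVec, hD.eq]

theorem firstCurvature_nonneg (r : ℝ → EuclideanSpace ℝ (Fin n)) (t : ℝ) :
    0 ≤ firstCurvature r t := by
  unfold firstCurvature
  positivity

/-- The curvature is the distance from the acceleration to the tangent line, divided by the
squared speed. -/
theorem firstCurvature_eq {r : ℝ → EuclideanSpace ℝ (Fin n)} {t : ℝ}
    {y : EuclideanSpace ℝ (Fin n)} (h : HasDerivAt (deriv r) y t) (h0 : deriv r t ≠ 0) :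
    firstCurvature r t = ‖deriv r t‖⁻¹ ^ 2 *
      ‖y - (inner ℝ (deriv r t) y / ‖deriv r t‖ ^ 2) • deriv r t‖ := by
  have hn : ‖deriv r t‖ ≠ 0 := norm_ne_zero_iff.2 h0
  have hsq : HasDerivAt (fun u => ‖deriv r u‖ ^ 2) (2 * inner ℝ (deriv r t) y) t := h.norm_sq
  have hnorm : HasDerivAt (fun u => ‖deriv r u‖) (inner ℝ (deriv r t) y / ‖deriv r t‖) t := by
    have := hsq.sqrt (pow_ne_zero 2 hn)
    simp only [Real.sqrt_sq (norm_nonneg _)] at this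
    convert this using 1
    field_simp
  have hT : HasDerivAt (unitTangent r) (‖deriv r t‖⁻¹ •
      (y - (inner ℝ (deriv r t) y / ‖deriv r t‖ ^ 2) • deriv r t)) t := by
    refine ((hnorm.inv hn).smul h).congr_deriv ?_
    simp only [Pi.inv_apply]
    symm
    rw [smul_sub, smul_smul, sub_eq_add_neg, ← neg_smul]
    congr 2
    field_simp
  rw [firstCurvature, hT.deriv, norm_smul, norm_inv, norm_norm]
  ring

/-- By Pythagoras, the orthogonal projection is the nearest point of the line. -/
theorem norm_sub_proj_le (x y : EuclideanSpace ℝ (Fin n)) (c : ℝ) :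
    ‖y - (inner ℝ x y / ‖x‖ ^ 2) • x‖ ≤ ‖y - c • x‖ := by
  rcases eq_or_ne x 0 with rfl | hx
  · simp
  have hn : ‖x‖ ^ 2 ≠ 0 := pow_ne_zero 2 (norm_ne_zero_iff.2 hx)
  set d := inner ℝ x y / ‖x‖ ^ 2 with hd
  have horth : inner ℝ (y - d • x) ((d - c) • x) = 0 := by
    rw [inner_smul_right, inner_sub_left, inner_smul_left, real_inner_self_eq_norm_sq,
      real_inner_comm, hd]
    simp [div_mul_cancel₀ _ hn]
  have hsum : y - c • x = (y - d • x) + (d - c) • x := by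
    rw [sub_smul]; abel
  rw [hsum]
  have := norm_add_sq_eq_norm_sq_add_norm_sq_of_inner_eq_zero _ _ horth
  nlinarith [norm_nonneg (y - d • x), norm_nonneg (y - d • x + (d - c) • x),
    mul_self_nonneg ‖(d - c) • x‖]

theorem IsTrajectory.firstCurvature_le {A D D' : Matrix (Fin n) (Fin n) ℝ}
    {r s : ℝ → EuclideanSpace ℝ (Fin n)} (hr : IsTrajectory A r) (hs : IsTrajectory A s)
    (hD : Commute D A) (hD' : Commute D' A) (hrs : Matrix.toEuclideanLin D (r 0) = s 0)
    (hsr : Matrix.toEuclideanLin D' (s 0) = r 0) :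
    ∃ K : ℝ, 0 < K ∧ ∀ t, firstCurvature s t ≤ K * firstCurvature r t := by
  set F := (Matrix.toEuclideanLin D).toContinuousLinearMap
  set F' := (Matrix.toEuclideanLin D').toContinuousLinearMap
  have hderiv : ∀ t, deriv s t = F (deriv r t) := fun t => by
    rw [← (hr.map hD).eq_of_initial_eq hs hrs]
    exact (F.hasFDerivAt.comp_hasDerivAt t (hr t).differentiableAt.hasDerivAt).deriv
  have hderiv' : ∀ t, deriv r t = F' (deriv s t) := fun t => by
    rw [← (hs.map hD').eq_of_initial_eq hr hsr]
    exact (F'.hasFDerivAt.comp_hasDerivAt t (hs t).differentiableAt.hasDerivAt).deriv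
  -- The `+ 1` only makes the constant positive, as needed for divergence to infinity.
  refine ⟨‖F'‖ ^ 2 * ‖F‖ + 1, by positivity, fun t => ?_⟩
  have hκ := firstCurvature_nonneg r t
  suffices H : firstCurvature s t ≤ ‖F'‖ ^ 2 * ‖F‖ * firstCurvature r t by linarith
  by_cases hs0 : deriv s t = 0
  · rw [firstCurvature, hs0, norm_zero, inv_zero, zero_mul]
    positivity
  have hr0 : deriv r t ≠ 0 := fun h => hs0 (by rw [hderiv, h, map_zero])
  set x := deriv r t with hx
  have hxd := hr.hasDerivAt_deriv t
  set y := Matrix.toEuclideanLin A x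
  have hsd : HasDerivAt (deriv s) (F y) t := by
    rw [funext hderiv]
    exact F.hasFDerivAt.comp_hasDerivAt t hxd
  rw [firstCurvature_eq hsd hs0, firstCurvature_eq hxd hr0, ← hx]
  have hspeed : ‖deriv s t‖⁻¹ ≤ ‖F'‖ * ‖x‖⁻¹ := by
    have hle : ‖x‖ ≤ ‖F'‖ * ‖deriv s t‖ := by
      rw [hx, hderiv' t]
      exact F'.le_opNorm _
    have h1 : 0 < ‖x‖ := norm_pos_iff.2 hr0
    have h2 : 0 < ‖deriv s t‖ := norm_pos_iff.2 hs0
    rw [← div_eq_mul_inv, inv_eq_one_div, div_le_div_iff₀ h2 h1]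
    linarith
  have hdist : ‖F y - (inner ℝ (deriv s t) (F y) / ‖deriv s t‖ ^ 2) • deriv s t‖ ≤
      ‖F‖ * ‖y - (inner ℝ x y / ‖x‖ ^ 2) • x‖ := by
    -- Compare with the `F`-image of the point of the line through `x` nearest to `y`; it lies on
    -- the tangent line of `s`.
    refine (norm_sub_proj_le _ _ (inner ℝ x y / ‖x‖ ^ 2)).trans ?_
    rw [hderiv t, ← map_smul, ← map_sub]
    exact F.le_opNorm _
  calc _ ≤ (‖F'‖ * ‖x‖⁻¹) ^ 2 * (‖F‖ * ‖y - (inner ℝ x y / ‖x‖ ^ 2) • x‖) := by gcongr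
    _ = _ := by ring

end Curvature

/-! ### Transfer to `A` by conjugation, and conclusion -/

theorem exists_commute_genericInitialValues {n : ℕ} {A B P : Matrix (Fin n) (Fin n) ℝ}
    (hP : IsUnit P.det) (hAB : A = P⁻¹ * B * P) (hB : IsRealJordanForm B)
    {x y : EuclideanSpace ℝ (Fin n)} (hx : x ∈ genericInitialValues P)
    (hy : y ∈ genericInitialValues P) :
    ∃ D : Matrix (Fin n) (Fin n) ℝ, Commute D A ∧ Matrix.toEuclideanLin D x = y := by
  obtain ⟨v, hv, rfl⟩ := hx
  obtain ⟨w, -, rfl⟩ := hy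
  obtain ⟨C, hC, hCv⟩ := hB.exists_commute v w fun i => Finset.prod_ne_zero_iff.1 hv i (by simp)
  have hPP : P * P⁻¹ = 1 := Matrix.mul_nonsing_inv P hP
  have hmul : ∀ M N : Matrix (Fin n) (Fin n) ℝ,
      P⁻¹ * M * P * (P⁻¹ * N * P) = P⁻¹ * (M * N) * P := fun M N => by
    calc _ = P⁻¹ * M * (P * P⁻¹) * N * P := by simp only [Matrix.mul_assoc]
      _ = _ := by rw [hPP]; simp only [Matrix.mul_assoc, Matrix.one_mul]
  refine ⟨P⁻¹ * C * P, ?_, ?_⟩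
  · rw [hAB, Commute, SemiconjBy, hmul, hmul, hC.eq]
  · have h : P⁻¹ * C * P * P⁻¹ = P⁻¹ * C := by rw [Matrix.mul_assoc, hPP, Matrix.mul_one]
    simp only [Matrix.toLpLin_apply, Matrix.mulVec_mulVec, h]
    rw [← Matrix.mulVec_mulVec, hCv]

theorem corollary5p7 (n : ℕ) (A B P : Matrix (Fin n) (Fin n) ℝ) (hP : IsUnit P.det)
    (hAB : A = P⁻¹ * B * P) (hB : IsRealJordanForm B) :
    ((∃ r : ℝ → EuclideanSpace ℝ (Fin n), IsTrajectory A r ∧ r 0 ∈ genericInitialValues P ∧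
        Tendsto (firstCurvature r) atTop (𝓝 0)) →
      ∀ r : ℝ → EuclideanSpace ℝ (Fin n), IsTrajectory A r → r 0 ∈ genericInitialValues P →
        Tendsto (firstCurvature r) atTop (𝓝 0)) ∧
    ((∃ r : ℝ → EuclideanSpace ℝ (Fin n), IsTrajectory A r ∧ r 0 ∈ genericInitialValues P ∧
        Tendsto (firstCurvature r) atTop atTop) →
      ∀ r : ℝ → EuclideanSpace ℝ (Fin n), IsTrajectory A r → r 0 ∈ genericInitialValues P →
        Tendsto (firstCurvature r) atTop atTop) ∧
    ((∃ r : ℝ → EuclideanSpace ℝ (Fin n), IsTrajectory A r ∧ r 0 ∈ genericInitialValues P ∧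
        ∃ C : ℝ, ∀ t : ℝ, 0 ≤ t → |firstCurvature r t| ≤ C) →
      ∀ r : ℝ → EuclideanSpace ℝ (Fin n), IsTrajectory A r → r 0 ∈ genericInitialValues P →
        ∃ C : ℝ, ∀ t : ℝ, 0 ≤ t → |firstCurvature r t| ≤ C) := by
  have key : ∀ r s : ℝ → EuclideanSpace ℝ (Fin n), IsTrajectory A r → IsTrajectory A s →
      r 0 ∈ genericInitialValues P → s 0 ∈ genericInitialValues P →
      ∃ K : ℝ, 0 < K ∧ ∀ t, firstCurvature s t ≤ K * firstCurvature r t := by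
    intro r s hr hs hr0 hs0
    obtain ⟨D, hD, hrs⟩ := exists_commute_genericInitialValues hP hAB hB hr0 hs0
    obtain ⟨D', hD', hsr⟩ := exists_commute_genericInitialValues hP hAB hB hs0 hr0
    exact hr.firstCurvature_le hs hD hD' hrs hsr
  refine ⟨?_, ?_, ?_⟩
  · rintro ⟨r, hr, hr0, hlim⟩ s hs hs0
    obtain ⟨K, -, hle⟩ := key r s hr hs hr0 hs0
    exact squeeze_zero (firstCurvature_nonneg s) hle (by simpa using hlim.const_mul K)
  · rintro ⟨r, hr, hr0, hlim⟩ s hs hs0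
    -- Roles are swapped: divergence needs a lower bound for the curvature of `s`.
    obtain ⟨K, hK, hle⟩ := key s r hs hr hs0 hr0
    exact (tendsto_const_mul_atTop_of_pos hK).1 (tendsto_atTop_mono hle hlim)
  · rintro ⟨r, hr, hr0, C, hC⟩ s hs hs0
    obtain ⟨K, hK, hle⟩ := key r s hr hs hr0 hs0
    refine ⟨K * C, fun t ht => ?_⟩
    rw [abs_of_nonneg (firstCurvature_nonneg s t)]
    exact (hle t).trans (mul_le_mul_of_nonneg_left ((le_abs_self _).trans (hC t ht)) hK.le)
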